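/- Let $F_2$ be the free group of rank 2, with standard basis $\{a,b\}$. For a finite-index subgroup $N\le F_2$, let $\mathrm{Sch}(N)$ be the Schreier graph of the transitive action of $F_2$ on the finite set $F_2/N$ by left translation (distinct vertices $x,y$ are joined by an edge when $y=sx$ or $x=sy$ for some $s\in\{a,b\}$), with its path metric. There is a sequence $(N_n)_{n\in\mathbb N}$ of finite-index (not necessarily normal) subgroups of $F_2$, that is, of transitive finite permutation representations $F_2\to\mathrm{Sym}(F_2/N_n)$, which is faithful, i.e. $\bigcap_n N_n=\{1\}$ and every $g\neq 1$ in $F_2$ acts non-trivially on $F_2/N_n$ for all but finitely many $n$, and such that the coarse disjoint union $\bigsqcup_n \mathrm{Sch}(N_n)$ has bounded geometry and property (A). On the other hand $F_2$ is not amenable; so the equivalence "amenable $\Leftrightarrow$ box space has property (A)", which holds for sequences of normal subgroups, fails for non-normal ones. Here a coarse disjoint union of metric spaces $(X_n)_{n\in\mathbb N}$ is a metric space $(Y,d)$ such that (1) there are a map $p:Y\to\mathbb N$ and a non-decreasing function $\rho:[0,\infty)\to[0,\infty)$ with $\rho(t)\to\infty$ as $t\to\infty$, such that $p^{-1}(n)$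 is isometric to $X_n$ for every $n$ and $|2^{p(x)}-2^{p(y)}|\le\rho(d(x,y))$ for all $x,y\in Y$; and (2) for all $R>0$ and all $n\ne m$, the set of points of $p^{-1}(n)$ at distance at most $R$ from some point of $p^{-1}(m)$ is bounded. Such a space exists for every sequence of non-empty metric spaces and is unique up to coarse equivalence; the claim holds for every choice of it. A metric space $Y$ has bounded geometry if for every $R$ the cardinalities of its balls of radius $R$ are bounded by a finite constant. Such a $Y$ has property (A) if for all $R,\varepsilon>0$ there are $S>0$ and a map $\phi:Y\to\ell^2(Y)$ with $\|\phi(x)\|=1$ for all $x$, with $|1-\langle\phi(x_1),\phi(x_2)\rangle|\le\varepsilon$ whenever $d(x_1,x_2)\le R$, and with $\phi(x)$ supported in the ball of radius $S$ around $x$. A countable group $G$ is amenable if for a proper length function $\ell$ on $G$ and all $R,\varepsilon>0$ there is a unit vector $\xi\in\ell^2(G)$ with $\|\lambda(g)\xi-\xi\|\le\varepsilon$ for all $g$ with $\ell(g)\le R$, where $\lambda$ is the left regular representation. -/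

import Mathlib

open Filter

/-! ### Coarse disjoint unions -/

/-- `Y` is a coarse disjoint union of the sequence of metric spaces `X n`: there are a map
`p : Y → ℕ` whose fibre over `n` is isometric to `X n`, and a proper control function `ρ` with
`|2 ^ p x - 2 ^ p y| ≤ ρ (d (x, y))`; moreover, for `n ≠ m`, the points of the `n`-th piece at
distance at most `R` from the `m`-th piece form a bounded set, for every `R`. -/
def IsCoarseDisjointUnion (X : ℕ → Type*) [∀ n, MetricSpace (X n)]
    (Y : Type*) [MetricSpace Y] : Prop :=
  ∃ (p : Y → ℕ) (ρ : NNReal → NNReal),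
    Monotone ρ ∧ Tendsto ρ atTop atTop ∧
    (∀ n, Nonempty (X n ≃ᵢ {y : Y // p y = n})) ∧
    (∀ x y : Y, |(2 : ℝ) ^ p x - (2 : ℝ) ^ p y| ≤ ρ (nndist x y)) ∧
    (∀ (R : ℝ) (n m : ℕ), n ≠ m →
      Bornology.IsBounded {x : Y | p x = n ∧ ∃ y : Y, p y = m ∧ dist x y ≤ R})

/-- A distance on the disjoint union of pointed metric spaces: inside a piece it is the given one;
between pieces `n ≠ m` one travels to the base point, jumps by `|2 ^ n - 2 ^ m|`, and travels from
the other base point. -/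
noncomputable def sigmaFarDist (X : ℕ → Type*) [∀ n, MetricSpace (X n)] (b : ∀ n, X n)
    (x y : Σ n, X n) : ℝ :=
  if h : x.1 = y.1 then dist (h ▸ x.2) y.2
  else dist x.2 (b x.1) + |(2 : ℝ) ^ x.1 - (2 : ℝ) ^ y.1| + dist y.2 (b y.1)

theorem sigmaFarDist_same (X : ℕ → Type*) [∀ n, MetricSpace (X n)] (b : ∀ n, X n)
    (n : ℕ) (x y : X n) : sigmaFarDist X b ⟨n, x⟩ ⟨n, y⟩ = dist x y := by
  simp [sigmaFarDist]

theorem sigmaFarDist_ne (X : ℕ → Type*) [∀ n, MetricSpace (X n)] (b : ∀ n, X n)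
    {n m : ℕ} (h : n ≠ m) (x : X n) (y : X m) : sigmaFarDist X b ⟨n, x⟩ ⟨m, y⟩ =
      dist x (b n) + |(2 : ℝ) ^ n - (2 : ℝ) ^ m| + dist y (b m) := by
  simp [sigmaFarDist, h]

/-- `sigmaFarDist` is a metric. -/
noncomputable abbrev sigmaFarMetric (X : ℕ → Type*) [∀ n, MetricSpace (X n)] (b : ∀ n, X n) :
    MetricSpace (Σ n, X n) where
  dist := sigmaFarDist X b
  dist_self := by rintro ⟨n, x⟩; rw [sigmaFarDist_same, dist_self]
  dist_comm := by
    rintro ⟨n, x⟩ ⟨m, y⟩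
    by_cases h : n = m
    · subst h; rw [sigmaFarDist_same, sigmaFarDist_same, dist_comm]
    · rw [sigmaFarDist_ne X b h, sigmaFarDist_ne X b (Ne.symm h), abs_sub_comm]; ring
  dist_triangle := by
    rintro ⟨n, x⟩ ⟨m, y⟩ ⟨k, z⟩
    by_cases h₁ : n = m
    · subst h₁
      by_cases h₂ : n = k
      · subst h₂; simp only [sigmaFarDist_same]; exact dist_triangle x y z
      · rw [sigmaFarDist_same, sigmaFarDist_ne X b h₂, sigmaFarDist_ne X b h₂]
        linarith [dist_triangle x y (b n)]
    · by_cases h₂ : m = k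
      · subst h₂
        rw [sigmaFarDist_same, sigmaFarDist_ne X b h₁, sigmaFarDist_ne X b h₁]
        linarith [dist_triangle z y (b m), dist_comm y z]
      · rw [sigmaFarDist_ne X b h₁, sigmaFarDist_ne X b h₂]
        have hy : 0 ≤ dist y (b m) := dist_nonneg
        have ha := abs_nonneg ((2 : ℝ) ^ n - (2 : ℝ) ^ m)
        have hb := abs_nonneg ((2 : ℝ) ^ m - (2 : ℝ) ^ k)
        by_cases h₃ : n = k
        · subst h₃
          rw [sigmaFarDist_same]
          linarith [dist_triangle x (b n) z, dist_comm z (b n)]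
        · rw [sigmaFarDist_ne X b h₃]
          linarith [abs_sub_le ((2 : ℝ) ^ n) ((2 : ℝ) ^ m) ((2 : ℝ) ^ k)]
  eq_of_dist_eq_zero := by
    rintro ⟨n, x⟩ ⟨m, y⟩ h
    change sigmaFarDist X b ⟨n, x⟩ ⟨m, y⟩ = 0 at h
    by_cases hn : n = m
    · subst hn; rw [sigmaFarDist_same] at h; rw [eq_of_dist_eq_zero h]
    · exfalso
      rw [sigmaFarDist_ne X b hn] at h
      have h0 : 0 < |(2 : ℝ) ^ n - (2 : ℝ) ^ m| := by
        rw [abs_pos, sub_ne_zero]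
        intro h2
        exact hn ((pow_right_injective₀ (a := (2 : ℝ)) (by norm_num) (by norm_num)) h2)
      linarith [dist_nonneg (x := x) (y := b n), dist_nonneg (x := y) (y := b m)]

/-- Every sequence of nonempty metric spaces has a coarse disjoint union. -/
theorem exists_isCoarseDisjointUnion (X : ℕ → Type) [∀ n, MetricSpace (X n)]
    [∀ n, Nonempty (X n)] :
    ∃ (Y : Type) (_ : MetricSpace Y), IsCoarseDisjointUnion X Y := by
  let b : ∀ n, X n := fun n => Classical.arbitrary (X n)
  let _ : MetricSpace (Σ n, X n) := sigmaFarMetric X b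
  have hd : ∀ x y : Σ n, X n, dist x y = sigmaFarDist X b x y := fun _ _ => rfl
  refine ⟨Σ n, X n, inferInstance, Sigma.fst, id, monotone_id, tendsto_id, ?_, ?_, ?_⟩
  · intro n
    refine ⟨⟨⟨fun x => ⟨⟨n, x⟩, rfl⟩, fun y => y.2 ▸ y.1.2, ?_, ?_⟩, ?_⟩⟩
    · intro x; rfl
    · rintro ⟨⟨m, y⟩, h⟩; cases h; rfl
    · refine Isometry.of_dist_eq fun x y => ?_
      rw [Subtype.dist_eq, hd]
      exact sigmaFarDist_same X b n x y
  · rintro ⟨n, x⟩ ⟨m, y⟩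
    simp only [id, coe_nndist]
    by_cases h : n = m
    · subst h; simp
    · rw [hd, sigmaFarDist_ne X b h]
      linarith [dist_nonneg (x := x) (y := b n), dist_nonneg (x := y) (y := b m)]
  · intro R n m hnm
    refine (Metric.isBounded_iff_subset_closedBall (⟨n, b n⟩ : Σ n, X n)).2 ⟨R, ?_⟩
    rintro ⟨k, x⟩ ⟨hk, ⟨l, y⟩, hl, h⟩
    cases hk; cases hl
    rw [hd, sigmaFarDist_ne X b hnm] at h
    rw [Metric.mem_closedBall, hd, sigmaFarDist_same]
    linarith [abs_nonneg ((2 : ℝ) ^ k - (2 : ℝ) ^ l), dist_nonneg (x := y) (y := b l)]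

/-! ### Bounded geometry and property (A) -/

/-- Bounded geometry: balls of a given radius are finite, with uniformly bounded cardinality. -/
def HasBoundedGeometry (Y : Type*) [MetricSpace Y] : Prop :=
  ∀ R : ℝ, ∃ K : ℕ, ∀ x : Y, (Metric.closedBall x R).encard ≤ K

/-- Property (A), for a metric space with bounded geometry: for all `R, ε > 0` there are `S > 0`
and unit vectors `φ x ∈ ℓ²(Y)` supported in the `S`-ball around `x` with
`|1 - ⟨φ x₁, φ x₂⟩| ≤ ε` whenever `d (x₁, x₂) ≤ R`. -/
def HasPropertyA (Y : Type*) [MetricSpace Y] : Prop :=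
  HasBoundedGeometry Y ∧
  ∀ R : ℝ, 0 < R → ∀ ε : ℝ, 0 < ε →
    ∃ S : ℝ, 0 < S ∧ ∃ φ : Y → lp (fun _ : Y => ℂ) 2,
      (∀ x, ‖φ x‖ = 1) ∧
      (∀ x₁ x₂, dist x₁ x₂ ≤ R → ‖1 - inner ℂ (φ x₁) (φ x₂)‖ ≤ ε) ∧
      (∀ x y, φ x y ≠ 0 → dist x y ≤ S)

/-! ### Amenability -/

/-- A proper length function on a (discrete) group. -/
structure IsProperLength {G : Type*} [Group G] (ℓ : G → ℝ) : Prop where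
  nonneg : ∀ g, 0 ≤ ℓ g
  mul_le : ∀ g h, ℓ (g * h) ≤ ℓ g + ℓ h
  inv_eq : ∀ g, ℓ g⁻¹ = ℓ g
  eq_zero_iff : ∀ g, ℓ g = 0 ↔ g = 1
  finite_ball : ∀ R : ℝ, {g | ℓ g ≤ R}.Finite

theorem memℓp_leftTranslate {G : Type*} [Group G] (g : G) (ξ : lp (fun _ : G => ℂ) 2) :
    Memℓp (fun h : G => (ξ (g⁻¹ * h) : ℂ)) 2 := by
  have h2 : (0 : ℝ) < (2 : ENNReal).toReal := by norm_num
  have h := (memℓp_gen_iff h2).1 (lp.memℓp ξ)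
  exact (memℓp_gen_iff h2).2 (h.comp_injective (mul_right_injective g⁻¹))

/-- The left regular representation of `G` on `ℓ²(G)`: `(λ(g) ξ)(h) = ξ (g⁻¹ h)`. -/
def leftRegular {G : Type*} [Group G] (g : G) (ξ : lp (fun _ : G => ℂ) 2) :
    lp (fun _ : G => ℂ) 2 :=
  ⟨fun h : G => ξ (g⁻¹ * h), memℓp_leftTranslate g ξ⟩

/-- Amenability of a countable discrete group: for a proper length function and all `R, ε > 0`
there is a unit vector of `ℓ²(G)` moved by at most `ε` by every element of the `R`-ball. -/
def IsAmenableGroup (G : Type*) [Group G] : Prop :=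
  ∃ ℓ : G → ℝ, IsProperLength ℓ ∧
    ∀ R : ℝ, 0 < R → ∀ ε : ℝ, 0 < ε →
      ∃ ξ : lp (fun _ : G => ℂ) 2, ‖ξ‖ = 1 ∧ ∀ g : G, ℓ g ≤ R → ‖leftRegular g ξ - ξ‖ ≤ ε

/-! ### Schreier graphs and the free group of rank 2 -/

/-- The Schreier graph of an action of `G` on `X` with respect to `S ⊆ G`: distinct points are
adjacent when an element of `S` moves one to the other. -/
def schreierGraph {G : Type*} [Group G] (S : Set G) (X : Type*) [MulAction G X] :
    SimpleGraph X :=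
  SimpleGraph.fromRel fun x y => ∃ s ∈ S, s • x = y

theorem schreierGraph_reachable_smul {G : Type*} [Group G] {S : Set G}
    (hS : Subgroup.closure S = ⊤) {X : Type*} [MulAction G X] (g : G) :
    ∀ x : X, (schreierGraph S X).Reachable x (g • x) := by
  have hg : g ∈ Subgroup.closure S := hS ▸ Subgroup.mem_top g
  induction hg using Subgroup.closure_induction with
  | mem s hs =>
    intro x
    by_cases h : x = s • x
    · rw [← h]
    · exact SimpleGraph.Adj.reachable
        ((SimpleGraph.fromRel_adj _ _ _).2 ⟨h, Or.inl ⟨s, hs, rfl⟩⟩)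
  | one => intro x; rw [one_smul]
  | mul a b _ _ ha hb => intro x; rw [mul_smul]; exact (hb x).trans (ha _)
  | inv a _ ha => intro x; simpa using (ha (a⁻¹ • x)).symm

/-- The free group of rank 2. -/
abbrev F₂ : Type := FreeGroup (Fin 2)

/-- The word length of `F₂` for its standard basis is a proper length function. -/
theorem isProperLength_norm : IsProperLength fun g : F₂ => (g.norm : ℝ) where
  nonneg g := Nat.cast_nonneg _
  mul_le g h := by exact_mod_cast FreeGroup.norm_mul_le g h
  inv_eq g := by simp
  eq_zero_iff g := by simp
  finite_ball R := by
    refine Set.Finite.subset (((List.finite_length_le (Fin 2 × Bool) ⌊R⌋₊)).preimage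
      (f := FreeGroup.toWord) FreeGroup.toWord_injective.injOn) fun g hg => ?_
    exact Nat.le_floor hg

/-- The vertex set `F₂ / N` of the Schreier graph of the action of `F₂` on `F₂ / N`. -/
def Sch (N : Subgroup F₂) : Type := F₂ ⧸ N

instance (N : Subgroup F₂) : Nonempty (Sch N) := ⟨((1 : F₂) : F₂ ⧸ N)⟩

/-- The Schreier graph of `F₂` acting on `F₂ / N`, for the standard basis of `F₂`. -/
def schGraph (N : Subgroup F₂) : SimpleGraph (Sch N) :=
  schreierGraph (Set.range (FreeGroup.of : Fin 2 → F₂)) (F₂ ⧸ N)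

theorem schGraph_connected (N : Subgroup F₂) : (schGraph N).Connected := by
  refine ⟨fun x y => ?_⟩
  obtain ⟨g, rfl⟩ := MulAction.exists_smul_eq F₂ (show F₂ ⧸ N from x) (show F₂ ⧸ N from y)
  exact schreierGraph_reachable_smul (FreeGroup.closure_range_of (Fin 2)) g (show F₂ ⧸ N from x)

/-- The Schreier graph is a metric space for its path metric. -/
noncomputable instance (N : Subgroup F₂) : MetricSpace (Sch N) where
  dist x y := ((schGraph N).dist x y : ℝ)
  dist_self x := by simp
  dist_comm x y := by rw [SimpleGraph.dist_comm]
  dist_triangle x y z := by exact_mod_cast (schGraph_connected N).dist_triangle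
  eq_of_dist_eq_zero {x y} h := by
    have h' : (schGraph N).dist x y = 0 := by exact_mod_cast h
    exact (schGraph_connected N).dist_eq_zero_iff.1 h'

/-- Every sequence of these Schreier graphs has a coarse disjoint union. -/
theorem exists_isCoarseDisjointUnion_sch (N : ℕ → Subgroup F₂) :
    ∃ (Y : Type) (_ : MetricSpace Y), IsCoarseDisjointUnion (fun n => Sch (N n)) Y :=
  exists_isCoarseDisjointUnion fun n => Sch (N n)

/-- A sequence of subgroups `N n`, i.e. of transitive permutation representations `G → Sym(G / N n)`,
is faithful if the subgroups have trivial intersection and every nontrivial element of `G` acts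
nontrivially on all but finitely many of the sets `G / N n`. -/
def IsFaithfulSequence {G : Type*} [Group G] (N : ℕ → Subgroup G) : Prop :=
  (⨅ n, N n) = ⊥ ∧
  ∀ g : G, g ≠ 1 → ∀ᶠ n in atTop, ∃ x : G ⧸ N n, g • x ≠ x

/-! ### Non-amenability of the free group -/

/-! Non-amenability is the paradoxical decomposition: for each generator `s`, every element either
starts with `s` or becomes a word starting with `s⁻¹` after left multiplication by `s⁻¹`. An almost
invariant unit vector therefore has almost full mass on words starting with `s` or `s⁻¹`, for both
generators, although these two sets are disjoint (`norm_sq_le_of_cover`, `mem_startsWith_or`).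

For the subgroups, embed `F₂` in the free product of three groups of order two by `a ↦ xy`, `b ↦
yz`. A nontrivial element becomes a nonempty word without repeated adjacent letters
(`exists_word_of_ne_one`). Such a word colours the edges of a finite path properly, and each
involution swaps the ends of the edges of its colour. If the colouring contains the word of `g`,
then `g` moves the vertex at the end of that stretch to its beginning (`exists_pathAction_ne`).
Hence a path coloured by a word containing those of the first `n + 1` elements of an enumeration
sees them all, and `N n` is the stabilizer of a vertex moved by element number `n`.

The action is transitive on the path, and its Schreier graph is bi-Lipschitz to an interval with
constants independent of `n` (`exists_sch_pathStabilizer_coord`). Intervals have property (A)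
uniformly, through normalised indicators of long windows, and the far-apart pieces interact only in
a finite set (`IsFarUnionOfIntervals.hasPropertyA`). -/

theorem lp_two_hasSum_norm_sq {ι : Type*} (f : lp (fun _ : ι => ℂ) 2) :
    HasSum (fun i => ‖f i‖ ^ 2) (‖f‖ ^ 2) := by
  have h := lp.hasSum_norm (p := 2) (by norm_num) f
  simpa using h

/-- If `A` and `g A'` cover `G`, a vector almost fixed by `g` has almost all its mass on
`A` and `A'`. -/
theorem norm_sq_le_of_cover {G : Type*} [Group G] (g : G) (A A' : Set G)
    (hcov : ∀ h, h ∈ A ∨ g⁻¹ * h ∈ A') (ξ : lp (fun _ : G => ℂ) 2) :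
    ‖ξ‖ ^ 2 ≤ (11 / 10) * (∑' h, A.indicator (fun h => ‖ξ h‖ ^ 2) h)
      + (11 / 10) * (∑' h, A'.indicator (fun h => ‖ξ h‖ ^ 2) h)
      + 11 * ‖leftRegular g ξ - ξ‖ ^ 2 := by
  have hξ := lp_two_hasSum_norm_sq ξ
  have hA := (hξ.summable.indicator A).hasSum
  have hA' := (hξ.summable.indicator A').hasSum
  have hA'g := (Equiv.mulLeft g⁻¹).hasSum_iff.2 hA'
  have hd := lp_two_hasSum_norm_sq (leftRegular g ξ - ξ)
  refine hasSum_le ?_ hξ (((hA.mul_left (11 / 10)).add (hA'g.mul_left (11 / 10))).add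
    (hd.mul_left 11))
  intro h
  have hval : (leftRegular g ξ - ξ) h = ξ (g⁻¹ * h) - ξ h := rfl
  simp only [Function.comp, Equiv.coe_mulLeft, hval]
  have h0 : ∀ (S : Set G) k, 0 ≤ S.indicator (fun h => ‖ξ h‖ ^ 2) k := fun S k =>
    Set.indicator_nonneg (fun _ _ => by positivity) k
  rcases hcov h with hh | hh
  · rw [Set.indicator_of_mem hh]
    have := h0 A' (g⁻¹ * h)
    nlinarith [sq_nonneg ‖ξ h‖, sq_nonneg ‖ξ (g⁻¹ * h) - ξ h‖]
  · rw [Set.indicator_of_mem hh]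
    have := h0 A h
    have ht : ‖ξ h‖ ≤ ‖ξ (g⁻¹ * h)‖ + ‖ξ (g⁻¹ * h) - ξ h‖ := by
      have := norm_sub_le (ξ (g⁻¹ * h)) (ξ (g⁻¹ * h) - ξ h)
      simpa using this
    have ht2 : ‖ξ h‖ ^ 2 ≤ (‖ξ (g⁻¹ * h)‖ + ‖ξ (g⁻¹ * h) - ξ h‖) ^ 2 := by gcongr
    -- This is `(u + v)² ≤ (11/10) u² + 11 v²`, the source of both constants; it amounts to `(u - 10
    -- v)² ≥ 0`.
    nlinarith [sq_nonneg (‖ξ (g⁻¹ * h)‖ - 10 * ‖ξ (g⁻¹ * h) - ξ h‖)]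

/-- The elements of `F₂` whose reduced word starts with a given letter. -/
def startsWith (l : Fin 2 × Bool) : Set F₂ := {g | g.toWord.head? = some l}

/-- If the reduced word of `g` does not start with the letter, prepending the inverse letter causes
no cancellation. -/
theorem mem_startsWith_or (i : Fin 2) (g : F₂) :
    g ∈ startsWith (i, true) ∨ (FreeGroup.of i)⁻¹ * g ∈ startsWith (i, false) := by
  by_cases hg : g ∈ startsWith (i, true)
  · exact Or.inl hg
  right
  have hw : (FreeGroup.of i)⁻¹ * g = FreeGroup.mk ((i, false) :: g.toWord) := by
    conv_lhs => rw [← FreeGroup.mk_toWord (x := g)]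
    rw [FreeGroup.of, FreeGroup.inv_mk, FreeGroup.mul_mk]
    rfl
  have hr : FreeGroup.reduce ((i, false) :: g.toWord) = (i, false) :: g.toWord := by
    rw [FreeGroup.reduce.cons, FreeGroup.reduce_toWord]
    have hg' : g.toWord.head? ≠ some (i, true) := hg
    cases h : g.toWord with
    | nil => rfl
    | cons x t =>
      obtain ⟨j, c⟩ := x
      rw [h] at hg'
      have : ¬ (i = j ∧ false = !c) := by
        rintro ⟨rfl, hc⟩
        cases c
        · exact absurd hc (by decide)
        · exact hg' rfl
      simp only [this, if_false]
  rw [startsWith, Set.mem_ofPred_eq, hw, FreeGroup.toWord_mk, hr, List.head?_cons]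

/-- The four sets of words with a prescribed first letter are disjoint, so their masses add up to at
most 1. Summing the covering inequality over the two generators would give `2 ≤ 11/10 + 22/10000`.
-/
theorem not_isAmenableGroup_F₂ : ¬ IsAmenableGroup F₂ := by
  rintro ⟨ℓ, -, h⟩
  obtain ⟨ξ, hξ, hm⟩ := h (max 1 (max (ℓ (FreeGroup.of 0)) (ℓ (FreeGroup.of 1))))
    (by positivity) (1 / 100) (by norm_num)
  have key : ∀ i : Fin 2, ‖leftRegular (FreeGroup.of i) ξ - ξ‖ ^ 2 ≤ (1 / 100) ^ 2 := by
    intro i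
    refine pow_le_pow_left₀ (norm_nonneg _) (hm _ ?_) 2
    fin_cases i <;> simp
  have c0 := norm_sq_le_of_cover _ _ _ (mem_startsWith_or 0) ξ
  have c1 := norm_sq_le_of_cover _ _ _ (mem_startsWith_or 1) ξ
  have k0 := key 0
  have k1 := key 1
  have hs := lp_two_hasSum_norm_sq ξ
  have hS := fun l => (hs.summable.indicator (startsWith l)).hasSum
  have tot := hasSum_le (fun g => ?_) (hasSum_sum fun l (_ : l ∈ Finset.univ) => hS l) hs
  · rw [Fintype.sum_prod_type] at tot
    simp only [Fin.sum_univ_two, Fintype.sum_bool] at tot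
    rw [hξ] at c0 c1 tot
    linarith
  · cases hg : g.toWord.head? with
    | none =>
      rw [Finset.sum_eq_zero]
      · positivity
      · intro l _
        exact Set.indicator_of_notMem (by simp [startsWith, hg]) _
    | some l =>
      rw [Finset.sum_eq_single l]
      · exact Set.indicator_le_self' (fun _ _ => by positivity) g
      · intro k _ hk
        refine Set.indicator_of_notMem ?_ _
        rw [startsWith, Set.mem_ofPred_eq, hg]
        exact fun h => hk (Option.some_injective _ h).symm
      · simp

/-! ### A criterion for property (A) -/

/-- Property (A) from finite sets: it suffices to find, for all `R` and `ε`, nonempty finite sets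
`W x` at bounded distance from `x` such that `W x` and `W y` have the same size and overlap up to
a proportion `ε` whenever `d (x, y) ≤ R`. -/
theorem hasPropertyA_of_finset {Y : Type*} [MetricSpace Y] [DecidableEq Y]
    (hb : HasBoundedGeometry Y)
    (h : ∀ R : ℝ, 0 < R → ∀ ε : ℝ, 0 < ε → ∃ S : ℝ, ∃ W : Y → Finset Y,
      (∀ x, (W x).Nonempty) ∧
      (∀ x y, dist x y ≤ R → (W x).card = (W y).card ∧
        (1 - ε) * (W x).card ≤ (W x ∩ W y).card) ∧
      (∀ x, ∀ z ∈ W x, dist x z ≤ S)) : HasPropertyA Y := by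
  refine ⟨hb, fun R hR ε hε => ?_⟩
  obtain ⟨S, W, hne, hov, hS⟩ := h R hR ε hε
  -- `φ x` is the normalised indicator of `W x`, so inner products count the overlaps.
  let c : Y → ℂ := fun x => (((Real.sqrt (W x).card)⁻¹ : ℝ) : ℂ)
  let φ : Y → lp (fun _ : Y => ℂ) 2 := fun x => ∑ z ∈ W x, lp.single 2 z (c x)
  have hφ : ∀ x y, φ x y = if y ∈ W x then c x else 0 := by
    intro x y
    simp only [φ]
    rw [lp.coeFn_sum, Finset.sum_apply]
    simp [Pi.single_apply]
  have hinner : ∀ x y, inner ℂ (φ x) (φ y) =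
      (((Real.sqrt (W x).card)⁻¹ * (Real.sqrt (W y).card)⁻¹ * (W x ∩ W y).card : ℝ) : ℂ) := by
    intro x y
    conv_lhs => enter [2]; simp only [φ]
    rw [sum_inner]
    simp only [lp.inner_single_left, hφ]
    simp only [RCLike.inner_apply, c, ite_mul, zero_mul, Complex.conj_ofReal]
    rw [← Finset.sum_filter, Finset.filter_mem_eq_inter, Finset.sum_const]
    push_cast
    rw [nsmul_eq_mul]; ring
  have hpos : ∀ x, (0 : ℝ) < (W x).card := fun x => by exact_mod_cast (hne x).card_pos
  refine ⟨max S 1, by positivity, φ, ?_, ?_, ?_⟩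
  · intro x
    have h1 : inner ℂ (φ x) (φ x) = 1 := by
      rw [hinner, Finset.inter_self, ← mul_inv, Real.mul_self_sqrt (hpos x).le,
        inv_mul_cancel₀ (hpos x).ne']
      simp
    rw [inner_self_eq_norm_sq_to_K] at h1
    have h2 : ‖φ x‖ ^ 2 = 1 := Complex.ofReal_injective (by simpa using h1)
    exact (pow_eq_one_iff_of_nonneg (norm_nonneg _) two_ne_zero).1 h2
  · intro x y hxy
    obtain ⟨hc, ho⟩ := hov x y hxy
    rw [hinner, ← hc, ← mul_inv, Real.mul_self_sqrt (hpos x).le, ← Complex.ofReal_one,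
      ← Complex.ofReal_sub, Complex.norm_real, Real.norm_eq_abs]
    have hle : ((W x ∩ W y).card : ℝ) ≤ (W x).card := by
      exact_mod_cast Finset.card_le_card Finset.inter_subset_left
    have h1 := hpos x
    rw [← div_eq_inv_mul, abs_le]
    constructor
    · have : ((W x ∩ W y).card : ℝ) / (W x).card ≤ 1 := (div_le_one h1).2 hle
      linarith
    · have : 1 - ε ≤ ((W x ∩ W y).card : ℝ) / (W x).card := (le_div_iff₀ h1).2 ho
      linarith
  · intro x y hy
    rw [hφ] at hy
    have : y ∈ W x := by by_contra h; simp [h] at hy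
    exact (hS x y this).trans (le_max_left _ _)

/-- A metric space cut into pieces `p ⁻¹ {n}` that are, uniformly in `n`, bi-Lipschitz to the
intervals `{0, …, m n - 1}`, the distance between two pieces tending to infinity with either
index. -/
structure IsFarUnionOfIntervals {Y : Type*} [MetricSpace Y] (p F : Y → ℕ) (m : ℕ → ℕ)
    (e : ℕ → ℕ → Y) : Prop where
  lt_size : ∀ x, F x < m (p x)
  piece_point : ∀ n i, i < m n → p (e n i) = n
  coord_point : ∀ n i, i < m n → F (e n i) = i
  eq_of_coord : ∀ x y, p x = p y → F x = F y → x = y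
  coord_le : ∀ x y, p x = p y → |(F x : ℝ) - F y| ≤ 2 * dist x y
  le_coord : ∀ x y, p x = p y → dist x y ≤ 2 * |(F x : ℝ) - F y|
  far : ∀ R : ℝ, ∃ k : ℕ, ∀ x y, dist x y ≤ R → p x ≠ p y → p x < k

namespace IsFarUnionOfIntervals

variable {Y : Type*} [MetricSpace Y] {p F : Y → ℕ} {m : ℕ → ℕ} {e : ℕ → ℕ → Y}

theorem point_coord (h : IsFarUnionOfIntervals p F m e) (x : Y) : e (p x) (F x) = x :=
  h.eq_of_coord _ _ (h.piece_point _ _ (h.lt_size x)) (h.coord_point _ _ (h.lt_size x))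

theorem point_injOn (h : IsFarUnionOfIntervals p F m e) (n : ℕ) :
    Set.InjOn (e n) {i | i < m n} := fun i hi j hj hij => by
  rw [← h.coord_point n i hi, hij, h.coord_point n j hj]

theorem finite_lt (h : IsFarUnionOfIntervals p F m e) (k : ℕ) : {x | p x < k}.Finite := by
  refine ((Finset.range k).finite_toSet.biUnion fun n _ =>
    ((Finset.range (m n)).finite_toSet.image (e n))).subset fun x hx => ?_
  simp only [Set.mem_iUnion]
  exact ⟨p x, by simpa using hx, F x, by simpa using h.lt_size x, h.point_coord x⟩

/-- Inside its own piece a ball of radius `R` meets at most `2r + 1` coordinates, where `r ≥ 2R`;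
its other points lie in the first `k` pieces, a finite set. -/
theorem hasBoundedGeometry (h : IsFarUnionOfIntervals p F m e) : HasBoundedGeometry Y := by
  classical
  intro R
  obtain ⟨k, hk⟩ := h.far R
  obtain ⟨r, hr⟩ := exists_nat_ge (2 * R)
  refine ⟨2 * r + 1 + (h.finite_lt k).toFinset.card, fun x => ?_⟩
  have hsub : Metric.closedBall x R ⊆
      ((Finset.Icc (F x - r) (F x + r)).image (e (p x)) ∪ (h.finite_lt k).toFinset :
        Finset Y) := by
    intro y hy
    rw [Metric.mem_closedBall] at hy
    rw [Finset.coe_union, Finset.coe_image]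
    by_cases hp : p y = p x
    · left
      refine ⟨F y, ?_, by rw [← hp, h.point_coord]⟩
      have h1 := (h.coord_le y x hp).trans (by linarith : _ ≤ (r : ℝ))
      rw [abs_le] at h1
      have h2 : F x ≤ F y + r := by
        have : (F x : ℝ) ≤ F y + r := by linarith
        exact_mod_cast this
      have h3 : F y ≤ F x + r := by
        have : (F y : ℝ) ≤ F x + r := by linarith
        exact_mod_cast this
      simp only [Finset.coe_Icc, Set.mem_Icc]
      omega
    · right
      simpa using hk y x hy hp
  refine (Set.encard_le_encard hsub).trans ?_
  rw [Set.encard_coe_eq_coe_finsetCard]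
  norm_cast
  refine (Finset.card_union_le _ _).trans ?_
  gcongr
  refine Finset.card_image_le.trans ?_
  rw [Nat.card_Icc]
  omega

/-- `W x` is a window of `l` consecutive points near `x`, or the whole piece if that is shorter.
Points of one piece at distance at most `R` have windows shifted by at most `2R ≤ ε l`. On the first
`k` pieces, the only ones where distinct pieces come `R`-close, all `W x` are one common singleton.
-/
theorem hasPropertyA (h : IsFarUnionOfIntervals p F m e) : HasPropertyA Y := by
  classical
  refine hasPropertyA_of_finset h.hasBoundedGeometry fun R hR ε hε => ?_
  obtain ⟨k, hk⟩ := h.far R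
  obtain ⟨l, hl⟩ := exists_nat_ge (max 1 (2 * R / ε))
  have hl1 : 1 ≤ l := by exact_mod_cast (le_max_left _ _).trans hl
  have hlR : 2 * R ≤ ε * l := by
    have := (le_max_right _ _).trans hl
    rwa [div_le_iff₀ hε, mul_comm (l : ℝ)] at this
  obtain ⟨D, hD⟩ := Metric.isBounded_iff.1 (h.finite_lt k).isBounded
  by_cases hY : Nonempty Y
  swap
  · exact ⟨1, fun _ => ∅, fun x => (hY ⟨x⟩).elim, fun x => (hY ⟨x⟩).elim, fun x => (hY ⟨x⟩).elim⟩
  obtain ⟨y₁⟩ := hY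
  -- The common point is taken in the first `k` pieces; if these are empty, it is never used.
  obtain ⟨y₀, hy₀⟩ : ∃ y₀, ∀ x, p x < k → p y₀ < k := by
    by_cases hx : ∃ x, p x < k
    · exact ⟨hx.choose, fun _ _ => hx.choose_spec⟩
    · exact ⟨y₁, fun x hx' => (hx ⟨x, hx'⟩).elim⟩
  -- `K x` is the window length; its left end `c x` is pushed back where the window would leave the
  -- piece.
  let K : Y → ℕ := fun x => min l (m (p x))
  let c : Y → ℕ := fun x => min (F x) (m (p x) - K x)
  let V : Y → Finset Y := fun x => (Finset.Ico (c x) (c x + K x)).image (e (p x))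
  have hK : ∀ x, K x ≤ l ∧ K x ≤ m (p x) ∧ 1 ≤ K x := fun x => by
    have := h.lt_size x
    simp only [K]; omega
  have hIco : ∀ x, ∀ i ∈ Finset.Ico (c x) (c x + K x), i < m (p x) := fun x i hi => by
    have := h.lt_size x
    have := hK x
    rw [Finset.mem_Ico] at hi
    simp only [c] at hi; omega
  have hV : ∀ x, (V x).card = K x := fun x => by
    rw [Finset.card_image_of_injOn, Nat.card_Ico]
    · omega
    · exact (h.point_injOn (p x)).mono (hIco x)
  refine ⟨max D (2 * l), fun x => if p x < k then {y₀} else V x, ?_, ?_, ?_⟩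
  · intro x
    dsimp only
    split_ifs
    · exact Finset.singleton_nonempty _
    · rw [← Finset.card_pos, hV]; exact (hK x).2.2
  · intro x y hxy
    by_cases hp : p x = p y
    · by_cases hx : p x < k
      · have hy : p y < k := hp ▸ hx
        simp only [hx, hy, if_true, Finset.inter_self, Finset.card_singleton, Nat.cast_one, true_and]
        linarith
      · have hy : ¬ p y < k := hp ▸ hx
        simp only [hx, hy, if_false, hV]
        have hKK : K x = K y := by simp only [K, hp]
        refine ⟨hKK, ?_⟩
        have hsub : (Finset.Ico (max (c x) (c y)) (min (c x) (c y) + K x)).image (e (p x))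
            ⊆ V x ∩ V y := by
          refine Finset.subset_inter (Finset.image_subset_image ?_) ?_
          · exact Finset.Ico_subset_Ico (le_max_left _ _) (by omega)
          · simp only [V, ← hp, ← hKK]
            exact Finset.image_subset_image (Finset.Ico_subset_Ico (le_max_right _ _) (by omega))
        have hcard := Finset.card_le_card hsub
        rw [Finset.card_image_of_injOn, Nat.card_Ico] at hcard
        swap
        · refine (h.point_injOn (p x)).mono fun i hi => hIco x i ?_
          rw [Finset.mem_coe, Finset.mem_Ico] at hi
          rw [Finset.mem_Ico]; omega
        have hcard' : (K x : ℝ) - |(c x : ℝ) - c y| ≤ (V x ∩ V y).card := by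
          rcases le_total (c x) (c y) with hc | hc
          · have : K x + c x ≤ (V x ∩ V y).card + c y := by omega
            have : (K x : ℝ) + c x ≤ (V x ∩ V y).card + c y := by exact_mod_cast this
            linarith [neg_abs_le ((c x : ℝ) - c y)]
          · have : K x + c y ≤ (V x ∩ V y).card + c x := by omega
            have : (K x : ℝ) + c y ≤ (V x ∩ V y).card + c x := by exact_mod_cast this
            linarith [le_abs_self ((c x : ℝ) - c y)]
        refine le_trans ?_ hcard'
        suffices |(c x : ℝ) - c y| ≤ ε * K x by linarith
        by_cases hm : m (p x) ≤ l
        · have hcx : c x = 0 := by simp only [c, K]; omega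
          have hcy : c y = 0 := by simp only [c, K, ← hp]; omega
          rw [hcx, hcy]; simp; positivity
        · have hKl : K x = l := by simp only [K]; omega
          have h1 : |(c x : ℝ) - c y| ≤ |(F x : ℝ) - F y| := by
            simp only [c, ← hKK, ← hp]
            push_cast
            exact abs_inf_sub_inf_le_abs _ _ _
          rw [hKl]
          linarith [h.coord_le x y hp]
    · have hx := hk x y hxy hp
      have hy := hk y x (by rwa [dist_comm]) (Ne.symm hp)
      simp only [hx, hy, if_true, Finset.inter_self, Finset.card_singleton, Nat.cast_one, true_and]
      linarith
  · intro x z hz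
    dsimp only at hz
    split_ifs at hz with hx
    · rw [Finset.mem_singleton.1 hz]
      exact (hD hx (hy₀ x hx)).trans (le_max_left _ _)
    · obtain ⟨i, hi, rfl⟩ := Finset.mem_image.1 hz
      have him := hIco x i hi
      refine le_trans ?_ (le_max_right _ _)
      refine (h.le_coord _ _ (h.piece_point _ _ him).symm).trans ?_
      rw [h.coord_point _ _ him]
      rw [Finset.mem_Ico] at hi
      have h1 : F x ≤ i + l ∧ i ≤ F x + l := by
        have := hK x
        have := h.lt_size x
        simp only [c] at hi; omega
      have h2 : (F x : ℝ) ≤ i + l := by exact_mod_cast h1.1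
      have h3 : (i : ℝ) ≤ F x + l := by exact_mod_cast h1.2
      have : |(F x : ℝ) - i| ≤ l := abs_le.2 ⟨by linarith, by linarith⟩
      linarith

end IsFarUnionOfIntervals

/-- This bounds the index of either of two distinct pieces by the distance between their points,
through the control function `ρ`. -/
theorem half_two_pow_le_abs_sub {i j : ℕ} (h : i ≠ j) :
    (2 : ℝ) ^ i / 2 ≤ |(2 : ℝ) ^ i - (2 : ℝ) ^ j| := by
  rcases lt_or_gt_of_ne h with h | h
  · have : (2 : ℝ) ^ (i + 1) ≤ 2 ^ j := pow_le_pow_right₀ (by norm_num) h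
    rw [pow_succ] at this
    rw [abs_sub_comm]
    have h0 : (0 : ℝ) < 2 ^ i := by positivity
    linarith [le_abs_self ((2 : ℝ) ^ j - 2 ^ i)]
  · have : (2 : ℝ) ^ (j + 1) ≤ 2 ^ i := pow_le_pow_right₀ (by norm_num) h
    rw [pow_succ] at this
    linarith [le_abs_self ((2 : ℝ) ^ i - 2 ^ j)]

/-- Coarse disjoint unions of spaces uniformly bi-Lipschitz to finite intervals have
property (A). -/
theorem IsCoarseDisjointUnion.hasPropertyA_of_intervals {X : ℕ → Type*} [∀ n, MetricSpace (X n)]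
    (m : ℕ → ℕ) (f : ∀ n, X n → ℕ) (hinj : ∀ n, Function.Injective (f n))
    (hrange : ∀ n, Set.range (f n) = {i | i < m n})
    (hf : ∀ n x y, |(f n x : ℝ) - f n y| ≤ 2 * dist x y)
    (hf' : ∀ n x y, dist x y ≤ 2 * |(f n x : ℝ) - f n y|)
    {Y : Type*} [MetricSpace Y] (hY : IsCoarseDisjointUnion X Y) : HasPropertyA Y := by
  classical
  obtain ⟨p, ρ, hρ, -, hiso, hfar, -⟩ := hY
  by_cases hne : Nonempty Y
  swap
  · refine hasPropertyA_of_finset (fun R => ⟨0, fun x => (hne ⟨x⟩).elim⟩) fun R _ ε _ =>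
      ⟨1, fun _ => ∅, fun x => (hne ⟨x⟩).elim, fun x => (hne ⟨x⟩).elim, fun x => (hne ⟨x⟩).elim⟩
  let φ : ∀ n, X n ≃ᵢ {y : Y // p y = n} := fun n => (hiso n).some
  let F : Y → ℕ := fun y => f (p y) ((φ (p y)).symm ⟨y, rfl⟩)
  have hF : ∀ n y (hy : p y = n), F y = f n ((φ n).symm ⟨y, hy⟩) := by
    rintro n y rfl; rfl
  have hd : ∀ n x y (hx : p x = n) (hy : p y = n),
      dist ((φ n).symm ⟨x, hx⟩) ((φ n).symm ⟨y, hy⟩) = dist x y := fun n x y hx hy =>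
    (φ n).symm.isometry.dist_eq _ _
  have hex : ∀ n i, ∃ y : Y, i < m n → p y = n ∧ F y = i := by
    intro n i
    by_cases hi : i < m n
    · obtain ⟨x, hx⟩ : i ∈ Set.range (f n) := by rw [hrange]; exact hi
      refine ⟨φ n x, fun _ => ⟨(φ n x).2, ?_⟩⟩
      rw [hF n _ (φ n x).2, ← hx]
      simp
    · exact ⟨hne.some, fun h => (hi h).elim⟩
  choose e he using hex
  refine IsFarUnionOfIntervals.hasPropertyA (p := p) (F := F) (m := m) (e := e)
    ⟨fun x => ?_, fun n i hi => (he n i hi).1, fun n i hi => (he n i hi).2, ?_, ?_, ?_, ?_⟩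
  · have : F x ∈ Set.range (f (p x)) := ⟨_, rfl⟩
    rwa [hrange] at this
  · intro x y hp hxy
    rw [hF (p x) y hp.symm] at hxy
    exact congrArg Subtype.val ((φ (p x)).symm.injective (hinj _ hxy))
  · intro x y hp
    rw [hF (p x) y hp.symm, hF (p x) x rfl, ← hd (p x) x y rfl hp.symm]
    exact hf _ _ _
  · intro x y hp
    rw [hF (p x) y hp.symm, hF (p x) x rfl, ← hd (p x) x y rfl hp.symm]
    exact hf' _ _ _
  · intro R
    obtain ⟨k, hk⟩ := pow_unbounded_of_one_lt (2 * (ρ R.toNNReal : ℝ)) (one_lt_two (α := ℝ))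
    refine ⟨k, fun x y hxy hp => ?_⟩
    have h1 : nndist x y ≤ R.toNNReal := by
      rw [← NNReal.coe_le_coe, coe_nndist]
      exact hxy.trans (Real.le_coe_toNNReal R)
    have h2 : (ρ (nndist x y) : ℝ) ≤ ρ R.toNNReal := by exact_mod_cast hρ h1
    have h3 : (2 : ℝ) ^ p x < 2 ^ k := by
      linarith [half_two_pow_le_abs_sub hp, hfar x y]
    exact (pow_lt_pow_iff_right₀ (one_lt_two (α := ℝ))).1 h3

/-! ### Words in three involutions -/

/-- Every nontrivial element of `F₂` becomes, under `a ↦ xy`, `b ↦ yz` for involutions `x, y, z`,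
a nonempty word in `x, y, z` without repeated adjacent letters. -/
theorem exists_isChain_word (H : Type*) [Group H] (L : List (Fin 2 × Bool))
    (hL : FreeGroup.IsReduced L) : ∃ w : List (Fin 3), w.IsChain (· ≠ ·) ∧
      (∀ t : Fin 3 → H, (∀ k, t k * t k = 1) →
        FreeGroup.lift ![t 0 * t 1, t 1 * t 2] (FreeGroup.mk L) = (w.map t).prod) ∧
      (L.head? = none → w = []) ∧
      (L.head? = some (0, true) → ∃ v, w = 0 :: v) ∧
      (L.head? = some (0, false) → ∃ v, w = 1 :: 0 :: v) ∧
      (L.head? = some (1, true) → ∃ v, w = 1 :: 2 :: v) ∧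
      (L.head? = some (1, false) → ∃ v, w = 2 :: v) := by
  -- The clauses on the first letter strengthen the induction. Only the junctions `a·b` and
  -- `b⁻¹·a⁻¹` cancel, each losing one pair `yy`; the known second letter `z` or `x` of the tail
  -- shows that cancellation stops there. After `a` and `b⁻¹` only one letter is guaranteed, as the
  -- second may have been cancelled.
  induction L with
  | nil => exact ⟨[], by simp, fun t _ => by simp [← FreeGroup.one_eq_mk], by simp⟩
  | cons l L ih =>
    obtain ⟨w, hw, ht, hn, hp0, hm0, hp1, hm1⟩ := ih (FreeGroup.IsReduced.infix hL ⟨[l], [], by simp⟩)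
    have hprod : ∀ t : Fin 3 → H, (∀ k, t k * t k = 1) →
        FreeGroup.lift ![t 0 * t 1, t 1 * t 2] (FreeGroup.mk (l :: L)) =
          FreeGroup.lift ![t 0 * t 1, t 1 * t 2] (FreeGroup.mk [l]) * (w.map t).prod := by
      intro t h
      rw [← ht t h, ← map_mul, FreeGroup.mul_mk]; rfl
    have hcancel : ∀ t : Fin 3 → H, (∀ k, t k * t k = 1) → ∀ k h, t k * (t k * h) = h := by
      intro t h k x
      rw [← mul_assoc, h, one_mul]
    have hinv : ∀ t : Fin 3 → H, (∀ k, t k * t k = 1) → ∀ k, (t k)⁻¹ = t k := fun t h k =>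
      inv_eq_of_mul_eq_one_left (h k)
    have hhead : ∀ l', L.head? = some l' → l.1 = l'.1 → l.2 = l'.2 := by
      intro l' hl'
      cases L with
      | nil => simp at hl'
      | cons l'' L =>
        cases hl'
        exact (List.isChain_cons_cons.1 hL).1
    obtain ⟨i, s⟩ := l
    cases hh : L.head? with
    | none =>
      obtain rfl := hn hh
      fin_cases i <;> cases s
      · exact ⟨[1, 0], by simp, fun t h => by rw [hprod t h]; simp [hinv t h], by simp⟩
      · exact ⟨[0, 1], by simp, fun t h => by rw [hprod t h]; simp, by simp⟩
      · exact ⟨[2, 1], by simp, fun t h => by rw [hprod t h]; simp [hinv t h], by simp⟩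
      · exact ⟨[1, 2], by simp, fun t h => by rw [hprod t h]; simp, by simp⟩
    | some l' =>
      have hl := hhead l' hh
      obtain ⟨j, r⟩ := l'
      rw [hh] at hp0 hm0 hp1 hm1
      have hcase : ((j, r) = (0, true) ∨ (j, r) = (0, false)) ∨
          ((j, r) = (1, true) ∨ (j, r) = (1, false)) := by
        fin_cases j <;> cases r <;> simp
      rcases hcase with (hc | hc) | (hc | hc) <;> obtain ⟨rfl, rfl⟩ := Prod.mk.inj hc
      · obtain ⟨v, rfl⟩ := hp0 rfl
        fin_cases i <;> cases s
        · exact absurd (hl rfl) (by simp)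
        · exact ⟨0 :: 1 :: 0 :: v, by simpa using hw,
            fun t h => by rw [hprod t h]; simp [mul_assoc], by simp⟩
        · exact ⟨2 :: 1 :: 0 :: v, by simpa using hw,
            fun t h => by rw [hprod t h]; simp [mul_assoc, hinv t h], by simp⟩
        · exact ⟨1 :: 2 :: 0 :: v, by simpa using hw,
            fun t h => by rw [hprod t h]; simp [mul_assoc], by simp⟩
      · obtain ⟨v, rfl⟩ := hm0 rfl
        fin_cases i <;> cases s
        · exact ⟨1 :: 0 :: 1 :: 0 :: v, by simpa using hw,
            fun t h => by rw [hprod t h]; simp [mul_assoc, hinv t h], by simp⟩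
        · exact absurd (hl rfl) (by simp)
        · refine ⟨2 :: 0 :: v, ?_, fun t h => by
            rw [hprod t h]; simp [mul_assoc, hinv t h, hcancel t h], by simp⟩
          rw [List.isChain_cons_cons] at hw ⊢
          exact ⟨by decide, hw.2⟩
        · exact ⟨1 :: 2 :: 1 :: 0 :: v, by simpa using hw,
            fun t h => by rw [hprod t h]; simp [mul_assoc], by simp⟩
      · obtain ⟨v, rfl⟩ := hp1 rfl
        fin_cases i <;> cases s
        · exact ⟨1 :: 0 :: 1 :: 2 :: v, by simpa using hw,
            fun t h => by rw [hprod t h]; simp [mul_assoc, hinv t h], by simp⟩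
        · refine ⟨0 :: 2 :: v, ?_, fun t h => by
            rw [hprod t h]; simp [mul_assoc, hcancel t h], by simp⟩
          rw [List.isChain_cons_cons] at hw ⊢
          exact ⟨by decide, hw.2⟩
        · exact absurd (hl rfl) (by simp)
        · exact ⟨1 :: 2 :: 1 :: 2 :: v, by simpa using hw,
            fun t h => by rw [hprod t h]; simp [mul_assoc], by simp⟩
      · obtain ⟨v, rfl⟩ := hm1 rfl
        fin_cases i <;> cases s
        · exact ⟨1 :: 0 :: 2 :: v, by simpa using hw,
            fun t h => by rw [hprod t h]; simp [mul_assoc, hinv t h], by simp⟩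
        · exact ⟨0 :: 1 :: 2 :: v, by simpa using hw,
            fun t h => by rw [hprod t h]; simp [mul_assoc], by simp⟩
        · exact ⟨2 :: 1 :: 2 :: v, by simpa using hw,
            fun t h => by rw [hprod t h]; simp [mul_assoc, hinv t h], by simp⟩
        · exact absurd (hl rfl) (by simp)

theorem exists_word_of_ne_one (H : Type*) [Group H] (g : F₂) (hg : g ≠ 1) :
    ∃ w : List (Fin 3), w ≠ [] ∧ w.IsChain (· ≠ ·) ∧
      ∀ t : Fin 3 → H, (∀ k, t k * t k = 1) →
        FreeGroup.lift ![t 0 * t 1, t 1 * t 2] g = (w.map t).prod := by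
  obtain ⟨w, hw, ht, -, hp0, hm0, hp1, hm1⟩ :=
    exists_isChain_word H g.toWord FreeGroup.isReduced_toWord
  rw [FreeGroup.mk_toWord] at ht
  refine ⟨w, ?_, hw, ht⟩
  cases hh : g.toWord.head? with
  | none =>
    rw [List.head?_eq_none_iff, FreeGroup.toWord_eq_nil_iff] at hh
    exact absurd hh hg
  | some l =>
    rw [hh] at hp0 hm0 hp1 hm1
    obtain ⟨i, s⟩ := l
    rintro rfl
    fin_cases i <;> cases s <;> simp_all

/-- With three letters available, one differs from both letters next to the junction. -/
theorem exists_isChain_append (L W : List (Fin 3)) (hL : L.IsChain (· ≠ ·))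
    (hW : W.IsChain (· ≠ ·)) : ∃ k, (L ++ k :: W).IsChain (· ≠ ·) := by
  obtain ⟨k, hk, hk'⟩ : ∃ k : Fin 3, (∀ x ∈ L.getLast?, x ≠ k) ∧ ∀ y ∈ W.head?, k ≠ y := by
    have h3 : ∀ u v : Option (Fin 3), ∃ k : Fin 3, (∀ x ∈ u, x ≠ k) ∧ ∀ y ∈ v, k ≠ y := by
      decide
    exact h3 _ _
  refine ⟨k, List.isChain_append.2 ⟨hL, List.isChain_cons.2 ⟨hk', hW⟩, ?_⟩⟩
  simpa using hk

theorem exists_isChain_infix (w : ℕ → List (Fin 3)) (hw : ∀ n, (w n).IsChain (· ≠ ·)) (n : ℕ) :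
    ∃ L : List (Fin 3), L.IsChain (· ≠ ·) ∧ ∀ i < n, w i <:+: L := by
  induction n with
  | zero => exact ⟨[], by simp, by simp⟩
  | succ n ih =>
    obtain ⟨L, hL, hi⟩ := ih
    obtain ⟨k, hk⟩ := exists_isChain_append L (w n) hL (hw n)
    refine ⟨_, hk, fun i hin => ?_⟩
    rcases Nat.lt_succ_iff_lt_or_eq.1 hin with h | rfl
    · exact (hi i h).trans (List.prefix_append _ _).isInfix
    · exact ⟨L ++ [k], [], by simp⟩

/-! ### Actions on edge-coloured paths -/

/-- The edge `{i, i + 1}` of `ℕ` is coloured by `c i`, if it is present. -/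
def IsProperColouring (c : ℕ → Option (Fin 3)) : Prop :=
  ∀ i k, c i = some k → c (i + 1) ≠ some k

/-- Exchange the end points of all edges of colour `k`. -/
def pathSwap (c : ℕ → Option (Fin 3)) (k : Fin 3) : ℕ → ℕ
  | 0 => if c 0 = some k then 1 else 0
  | i + 1 => if c (i + 1) = some k then i + 2 else if c i = some k then i else i + 1

theorem pathSwap_of_eq {c : ℕ → Option (Fin 3)} {k : Fin 3} {i : ℕ} (h : c i = some k) :
    pathSwap c k i = i + 1 := by
  cases i <;> simp [pathSwap, h]

theorem pathSwap_succ_of_eq {c : ℕ → Option (Fin 3)} (hc : IsProperColouring c) {k : Fin 3}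
    {i : ℕ} (h : c i = some k) : pathSwap c k (i + 1) = i := by
  simp [pathSwap, h, hc i k h]

theorem pathSwap_eq_self {c : ℕ → Option (Fin 3)} {k : Fin 3} {i : ℕ} (h : c i ≠ some k)
    (h' : ∀ j, i = j + 1 → c j ≠ some k) : pathSwap c k i = i := by
  cases i with
  | zero => simp [pathSwap, h]
  | succ i => simp [pathSwap, h, h' i rfl]

theorem pathSwap_cases {c : ℕ → Option (Fin 3)} (hc : IsProperColouring c) (k : Fin 3) (i : ℕ) :
    (c i = some k ∧ pathSwap c k i = i + 1) ∨
      (∃ j, i = j + 1 ∧ c j = some k ∧ pathSwap c k i = j) ∨ pathSwap c k i = i := by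
  by_cases h : c i = some k
  · exact Or.inl ⟨h, pathSwap_of_eq h⟩
  by_cases h' : ∃ j, i = j + 1 ∧ c j = some k
  · obtain ⟨j, rfl, hj⟩ := h'
    exact Or.inr (Or.inl ⟨j, rfl, hj, pathSwap_succ_of_eq hc hj⟩)
  · exact Or.inr (Or.inr (pathSwap_eq_self h fun j hj hj' => h' ⟨j, hj, hj'⟩))

theorem pathSwap_involutive {c : ℕ → Option (Fin 3)} (hc : IsProperColouring c) (k : Fin 3) :
    Function.Involutive (pathSwap c k) := by
  intro i
  rcases pathSwap_cases hc k i with ⟨h, h'⟩ | ⟨j, rfl, h, h'⟩ | h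
  · rw [h', pathSwap_succ_of_eq hc h]
  · rw [h', pathSwap_of_eq h]
  · rw [h, h]

/-- `pathSwap` as a permutation. -/
def pathPerm {c : ℕ → Option (Fin 3)} (hc : IsProperColouring c) (k : Fin 3) : Equiv.Perm ℕ :=
  (pathSwap_involutive hc k).toPerm

theorem pathPerm_mul_self {c : ℕ → Option (Fin 3)} (hc : IsProperColouring c) (k : Fin 3) :
    pathPerm hc k * pathPerm hc k = 1 := by
  ext i
  exact pathSwap_involutive hc k i

/-- The action of `F₂` on a properly edge-coloured path through products of two involutions. -/
def pathAction {c : ℕ → Option (Fin 3)} (hc : IsProperColouring c) : F₂ →* Equiv.Perm ℕ :=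
  FreeGroup.lift ![pathPerm hc 0 * pathPerm hc 1, pathPerm hc 1 * pathPerm hc 2]

/-- The rightmost letter acts first and crosses the last edge of the stretch; each further letter
crosses the preceding edge. -/
theorem pathPerm_prod_apply {c : ℕ → Option (Fin 3)} (hc : IsProperColouring c)
    (w : List (Fin 3)) (j : ℕ) (h : ∀ r < w.length, c (j + r) = w[r]?) :
    (w.map (pathPerm hc)).prod (j + w.length) = j := by
  induction w generalizing j with
  | nil => simp
  | cons k w ih =>
    have h1 := ih (j + 1) fun r hr => by
      have := h (r + 1) (by simpa using hr)
      rw [List.getElem?_cons_succ] at this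
      rw [← this]; congr 1; omega
    rw [List.map_cons, List.prod_cons, Equiv.Perm.mul_apply, List.length_cons,
      show j + (w.length + 1) = j + 1 + w.length by omega, h1]
    exact pathSwap_succ_of_eq hc (by simpa using h 0 (by simp))

theorem abs_pathPerm_sub_le {c : ℕ → Option (Fin 3)} (hc : IsProperColouring c) (k : Fin 3)
    (i : ℕ) : |(pathPerm hc k i : ℝ) - i| ≤ 1 := by
  change |(pathSwap c k i : ℝ) - i| ≤ 1
  rcases pathSwap_cases hc k i with ⟨h, h'⟩ | ⟨j, rfl, h, h'⟩ | h
  · rw [h']; simp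
  · rw [h']; simp
  · rw [h]; simp

theorem abs_pathAction_of_sub_le {c : ℕ → Option (Fin 3)} (hc : IsProperColouring c) (s : Fin 2)
    (i : ℕ) : |(pathAction hc (FreeGroup.of s) i : ℝ) - i| ≤ 2 := by
  have h : ∀ k k', |((pathPerm hc k * pathPerm hc k') i : ℝ) - i| ≤ 2 := by
    intro k k'
    rw [Equiv.Perm.mul_apply]
    have h1 := abs_pathPerm_sub_le hc k (pathPerm hc k' i)
    have h2 := abs_pathPerm_sub_le hc k' i
    linarith [abs_sub_le (pathPerm hc k (pathPerm hc k' i) : ℝ) (pathPerm hc k' i) i]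
  fin_cases s
  · simpa [pathAction] using h 0 1
  · simpa [pathAction] using h 1 2

/-- No edge leaves `{0, …, M}`, so every involution preserves it. -/
theorem pathAction_le {c : ℕ → Option (Fin 3)} (hc : IsProperColouring c) {M : ℕ}
    (hM : ∀ i, (c i).isSome ↔ i < M) (g : F₂) : ∀ i ≤ M, pathAction hc g i ≤ M := by
  have hk : ∀ k, ∀ i ≤ M, pathPerm hc k i ≤ M := by
    intro k i hi
    change pathSwap c k i ≤ M
    rcases pathSwap_cases hc k i with ⟨h, h'⟩ | ⟨j, rfl, h, h'⟩ | h
    · have := (hM i).1 (by simp [h])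
      omega
    · omega
    · omega
  have hki : ∀ k, ∀ i ≤ M, (pathPerm hc k)⁻¹ i ≤ M := by
    intro k
    rw [inv_eq_of_mul_eq_one_left (pathPerm_mul_self hc k)]
    exact hk k
  induction g using FreeGroup.induction_on with
  | C1 => simp
  | of s =>
    intro i hi
    fin_cases s
    · simpa [pathAction] using hk _ _ (hk _ _ hi)
    · simpa [pathAction] using hk _ _ (hk _ _ hi)
  | inv_of s _ =>
    intro i hi
    fin_cases s
    · simpa [pathAction] using hki _ _ (hki _ _ hi)
    · simpa [pathAction] using hki _ _ (hki _ _ hi)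
  | mul g h hg hh =>
    intro i hi
    rw [map_mul, Equiv.Perm.mul_apply]
    exact hg _ (hh _ hi)

/-! ### Schreier graphs of the path actions -/

theorem sch_dist_of_smul_le (N : Subgroup F₂) (s : Fin 2) (x : F₂ ⧸ N) :
    dist (α := Sch N) x (FreeGroup.of s • x : F₂ ⧸ N) ≤ 1 := by
  by_cases h : x = (FreeGroup.of s • x : F₂ ⧸ N)
  · rw [← h]; exact (dist_self (α := Sch N) x).trans_le zero_le_one
  · have hadj : (schGraph N).Adj x (FreeGroup.of s • x : F₂ ⧸ N) :=
      (SimpleGraph.fromRel_adj _ _ _).2 ⟨h, Or.inl ⟨_, ⟨s, rfl⟩, rfl⟩⟩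
    have := SimpleGraph.dist_eq_one_iff_adj.2 hadj
    change ((schGraph N).dist _ _ : ℝ) ≤ 1
    rw [this]; simp

theorem sch_dist_inv_smul_le (N : Subgroup F₂) {g : F₂} {C : ℝ}
    (h : ∀ x : F₂ ⧸ N, dist (α := Sch N) x (g • x : F₂ ⧸ N) ≤ C)
    (x : F₂ ⧸ N) : dist (α := Sch N) x (g⁻¹ • x : F₂ ⧸ N) ≤ C := by
  have := h (g⁻¹ • x)
  rw [smul_inv_smul] at this
  exact (dist_comm (α := Sch N) _ _).trans_le this

theorem sch_dist_mul_smul_le (N : Subgroup F₂) {g h : F₂} {C D : ℝ}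
    (hg : ∀ x : F₂ ⧸ N, dist (α := Sch N) x (g • x : F₂ ⧸ N) ≤ C)
    (hh : ∀ x : F₂ ⧸ N, dist (α := Sch N) x (h • x : F₂ ⧸ N) ≤ D)
    (x : F₂ ⧸ N) :
    dist (α := Sch N) x ((g * h) • x : F₂ ⧸ N) ≤ C + D := by
  have h1 := hg (h • x)
  have h2 := hh x
  rw [mul_smul]
  exact (dist_triangle _ _ _).trans (by rw [add_comm]; exact add_le_add h1 h2)

theorem abs_sub_le_of_sch_adj (N : Subgroup F₂) (f : Sch N → ℕ)
    (hf : ∀ x y, (schGraph N).Adj x y → |(f x : ℝ) - f y| ≤ 2) (x y : Sch N) :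
    |(f x : ℝ) - f y| ≤ 2 * dist x y := by
  obtain ⟨W, hW⟩ := (schGraph_connected N).exists_walk_length_eq_dist x y
  change _ ≤ 2 * ((schGraph N).dist x y : ℝ)
  rw [← hW]
  clear hW
  induction W with
  | nil => simp
  | cons h W ih =>
    rw [SimpleGraph.Walk.length_cons]
    push_cast
    exact (abs_sub_le _ _ _).trans (by linarith [hf _ _ h])

/-- The products `xy`, `yz`, `xz` come from `a`, `b`, `ab`, the reversed ones from the inverses, and
`kk` from 1: all have length at most 2. -/
theorem exists_pathAction_eq_mul {c : ℕ → Option (Fin 3)} (hc : IsProperColouring c)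
    (N : Subgroup F₂) (k k' : Fin 3) : ∃ g : F₂,
      pathAction hc g = pathPerm hc k * pathPerm hc k' ∧
      ∀ x : F₂ ⧸ N, dist (α := Sch N) x (g • x : F₂ ⧸ N) ≤ 2 := by
  have h0 := sch_dist_of_smul_le N 0
  have h1 := sch_dist_of_smul_le N 1
  have e0 : pathAction hc (FreeGroup.of 0) = pathPerm hc 0 * pathPerm hc 1 := by simp [pathAction]
  have e1 : pathAction hc (FreeGroup.of 1) = pathPerm hc 1 * pathPerm hc 2 := by simp [pathAction]
  have hinv : ∀ k, (pathPerm hc k)⁻¹ = pathPerm hc k := fun k =>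
    inv_eq_of_mul_eq_one_left (pathPerm_mul_self hc k)
  have e01 : pathAction hc (FreeGroup.of 0 * FreeGroup.of 1) = pathPerm hc 0 * pathPerm hc 2 := by
    rw [map_mul, e0, e1, mul_assoc, ← mul_assoc (pathPerm hc 1), pathPerm_mul_self, one_mul]
  have h01 := sch_dist_mul_smul_le N h0 h1
  have hdiag : ∀ k, ∃ g : F₂, pathAction hc g = pathPerm hc k * pathPerm hc k ∧
      ∀ x : F₂ ⧸ N, dist (α := Sch N) x (g • x : F₂ ⧸ N) ≤ 2 := fun k =>
    ⟨1, by rw [map_one, pathPerm_mul_self], fun x => by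
      rw [one_smul]; exact (dist_self (α := Sch N) x).trans_le zero_le_two⟩
  have hsymm : ∀ (k k' : Fin 3) (g : F₂) (C : ℝ), C ≤ 2 →
      pathAction hc g = pathPerm hc k * pathPerm hc k' →
      (∀ x : F₂ ⧸ N, dist (α := Sch N) x (g • x : F₂ ⧸ N) ≤ C) →
      (∃ g : F₂, pathAction hc g = pathPerm hc k * pathPerm hc k' ∧
        ∀ x : F₂ ⧸ N, dist (α := Sch N) x (g • x : F₂ ⧸ N) ≤ 2) ∧
      (∃ g : F₂, pathAction hc g = pathPerm hc k' * pathPerm hc k ∧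
        ∀ x : F₂ ⧸ N, dist (α := Sch N) x (g • x : F₂ ⧸ N) ≤ 2) :=
    fun k k' g C hC hg hd => ⟨⟨g, hg, fun x => (hd x).trans hC⟩, ⟨g⁻¹, by
      rw [map_inv, hg, mul_inv_rev, hinv, hinv],
      fun x => (sch_dist_inv_smul_le N hd x).trans hC⟩⟩
  have s0 := hsymm 0 1 _ _ (by norm_num) e0 h0
  have s1 := hsymm 1 2 _ _ (by norm_num) e1 h1
  have s2 := hsymm 0 2 _ _ (by norm_num) e01 h01
  fin_cases k <;> fin_cases k'
  exacts [hdiag 0, s0.1, s2.1, s0.2, hdiag 1, s1.1, s2.2, s1.2, hdiag 2]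

/-- Two consecutive vertices of the path are at distance at most `2` in the Schreier graph, since
each vertex is fixed by one of the involutions. -/
theorem exists_pathAction_eq_succ {c : ℕ → Option (Fin 3)} (hc : IsProperColouring c)
    (N : Subgroup F₂) (i : ℕ) (hi : (c i).isSome) : ∃ g : F₂, pathAction hc g i = i + 1 ∧
      ∀ x : F₂ ⧸ N, dist (α := Sch N) x (g • x : F₂ ⧸ N) ≤ 2 := by
  obtain ⟨k, hk⟩ := Option.isSome_iff_exists.1 hi
  have h3 : ∀ u v : Option (Fin 3), ∃ k : Fin 3, u ≠ some k ∧ v ≠ some k := by decide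
  -- At most two edges meet at `i`, so a third colour fixes it. For `i = 0` the truncated `i - 1`
  -- merely repeats `c 0`.
  obtain ⟨k', h1, h2⟩ := h3 (c i) (c (i - 1))
  obtain ⟨g, hg, hd⟩ := exists_pathAction_eq_mul hc N k k'
  refine ⟨g, ?_, hd⟩
  have : pathPerm hc k' i = i := pathSwap_eq_self h1 fun j hj => by
    rw [hj] at h2
    simpa using h2
  rw [hg, Equiv.Perm.mul_apply, this]
  exact pathSwap_of_eq hk

/-- The subgroup of elements of `F₂` fixing the vertex `q` of a coloured path. -/
def pathStabilizer {c : ℕ → Option (Fin 3)} (hc : IsProperColouring c) (q : ℕ) : Subgroup F₂ :=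
  (MulAction.stabilizer (Equiv.Perm ℕ) q).comap (pathAction hc)

theorem mem_pathStabilizer {c : ℕ → Option (Fin 3)} (hc : IsProperColouring c) (q : ℕ) (g : F₂) :
    g ∈ pathStabilizer hc q ↔ pathAction hc g q = q := Iff.rfl

/-- The Schreier graph of a vertex stabilizer of a coloured path is bi-Lipschitz to the path. -/
theorem exists_sch_pathStabilizer_coord {c : ℕ → Option (Fin 3)} (hc : IsProperColouring c) {M : ℕ}
    (hM : ∀ i, (c i).isSome ↔ i < M) {q : ℕ} (hq : q ≤ M) :
    ∃ f : Sch (pathStabilizer hc q) → ℕ,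
      Function.Injective f ∧ Set.range f = {i | i < M + 1} ∧
      (∀ x y, |(f x : ℝ) - f y| ≤ 2 * dist x y) ∧
      (∀ x y, dist x y ≤ 2 * |(f x : ℝ) - f y|) ∧
      (∀ (g : F₂) (x : F₂ ⧸ pathStabilizer hc q),
        f (g • x : F₂ ⧸ pathStabilizer hc q) = pathAction hc g (f x)) := by
  set N := pathStabilizer hc q with hN
  have hiff : ∀ g h : F₂, g⁻¹ * h ∈ N ↔ pathAction hc g q = pathAction hc h q := by
    intro g h
    rw [hN, mem_pathStabilizer, map_mul, map_inv, Equiv.Perm.mul_apply, Equiv.Perm.inv_eq_iff_eq]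
    exact eq_comm
  -- The orbit map of `q`, injective because `N` is the stabilizer of `q`.
  let f : F₂ ⧸ N → ℕ := fun x => Quotient.liftOn' x (fun g => pathAction hc g q) fun g h hgh =>
    (hiff g h).1 (QuotientGroup.leftRel_apply.1 hgh)
  have hfmk : ∀ g : F₂, f (g : F₂ ⧸ N) = pathAction hc g q := fun g => rfl
  have hequiv : ∀ (g : F₂) (x : F₂ ⧸ N), f (g • x) = pathAction hc g (f x) := by
    intro g x
    obtain ⟨h, rfl⟩ := QuotientGroup.mk_surjective x
    change f ((g * h : F₂) : F₂ ⧸ N) = _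
    rw [hfmk, hfmk, map_mul, Equiv.Perm.mul_apply]
  have hinj : Function.Injective f := by
    intro x y hxy
    obtain ⟨g, rfl⟩ := QuotientGroup.mk_surjective x
    obtain ⟨h, rfl⟩ := QuotientGroup.mk_surjective y
    exact QuotientGroup.eq.2 ((hiff g h).2 hxy)
  have hle : ∀ x, f x ≤ M := by
    intro x
    obtain ⟨g, rfl⟩ := QuotientGroup.mk_surjective x
    exact pathAction_le hc hM g q hq
  have hup : ∀ (n : ℕ) (x : F₂ ⧸ N), f x + n ≤ M → ∃ y : F₂ ⧸ N, f y = f x + n ∧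
      dist (α := Sch N) x y ≤ 2 * n := by
    intro n
    induction n with
    | zero => exact fun x _ => ⟨x, rfl, (dist_self (α := Sch N) x).trans_le (by simp)⟩
    | succ n ih =>
      intro x hx
      obtain ⟨y, hy, hd⟩ := ih x (by omega)
      obtain ⟨g, hg, hgd⟩ := exists_pathAction_eq_succ hc N (f y) ((hM _).2 (by omega))
      refine ⟨g • y, by rw [hequiv, hg, hy]; rfl, ?_⟩
      push_cast
      exact (dist_triangle (α := Sch N) x y (g • y : F₂ ⧸ N)).trans (by linarith [hgd y])
  have hdown : ∀ (n : ℕ) (x : F₂ ⧸ N), n ≤ f x → ∃ y : F₂ ⧸ N, f y + n = f x := by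
    intro n
    induction n with
    | zero => exact fun x _ => ⟨x, rfl⟩
    | succ n ih =>
      intro x hx
      obtain ⟨y, hy⟩ := ih x (by omega)
      have := hle x
      obtain ⟨g, hg, -⟩ := exists_pathAction_eq_succ hc N (f y - 1) ((hM _).2 (by omega))
      refine ⟨g⁻¹ • y, ?_⟩
      have : (pathAction hc g)⁻¹ (f y) = f y - 1 := by
        rw [Equiv.Perm.inv_eq_iff_eq, hg]; omega
      rw [hequiv, map_inv, this]
      omega
  have hlow : ∀ x y, f x ≤ f y →
      dist (α := Sch N) x y ≤ 2 * ((f y : ℝ) - f x) := by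
    intro x y hxy
    obtain ⟨z, hz, hd⟩ := hup (f y - f x) x (by have := hle y; omega)
    have : z = y := hinj (by omega)
    rw [this, Nat.cast_sub hxy] at hd
    exact hd
  refine ⟨f, hinj, ?_, abs_sub_le_of_sch_adj N f ?_, ?_, hequiv⟩
  · ext i
    constructor
    · rintro ⟨x, rfl⟩
      exact Nat.lt_succ_of_le (hle x)
    · intro hi
      have hi : i < M + 1 := hi
      -- Transitivity: descend from `q` to the end vertex 0, then climb to `i`.
      obtain ⟨y, hy⟩ := hdown (f ((1 : F₂) : F₂ ⧸ N)) _ le_rfl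
      obtain ⟨z, hz, -⟩ := hup i y (by omega)
      exact ⟨z, by omega⟩
  · intro x y hxy
    rcases ((SimpleGraph.fromRel_adj _ _ _).1 hxy).2 with ⟨_, ⟨s, rfl⟩, rfl⟩ | ⟨_, ⟨s, rfl⟩, rfl⟩
    · rw [abs_sub_comm]
      exact (hequiv _ x).symm ▸ abs_pathAction_of_sub_le hc s (f x)
    · exact (hequiv _ y).symm ▸ abs_pathAction_of_sub_le hc s (f y)
  · intro x y
    rcases le_total (f x) (f y) with h | h
    · rw [abs_sub_comm, abs_of_nonneg (sub_nonneg.2 (Nat.cast_le.2 h))]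
      exact hlow x y h
    · rw [abs_of_nonneg (sub_nonneg.2 (Nat.cast_le.2 h)), dist_comm]
      exact hlow y x h

theorem isProperColouring_getElem? {L : List (Fin 3)} (hL : L.IsChain (· ≠ ·)) :
    IsProperColouring fun i => L[i]? := by
  intro i k hi hi'
  obtain ⟨h1, h1'⟩ := List.getElem?_eq_some_iff.1 hi
  obtain ⟨h2, h2'⟩ := List.getElem?_eq_some_iff.1 hi'
  exact List.isChain_iff_getElem.1 hL i h2 (h1'.trans h2'.symm)

/-- A coloured path containing the word of a nontrivial element has a vertex moved by it. -/
theorem exists_pathAction_ne {L w : List (Fin 3)} (hL : L.IsChain (· ≠ ·)) (hw : w ≠ [])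
    (hwL : w <:+: L) {g : F₂} (hg : ∀ t : Fin 3 → Equiv.Perm ℕ, (∀ k, t k * t k = 1) →
      FreeGroup.lift ![t 0 * t 1, t 1 * t 2] g = (w.map t).prod) :
    ∃ q ≤ L.length, pathAction (isProperColouring_getElem? hL) g q ≠ q := by
  obtain ⟨P, Q, h⟩ := hwL
  have hpos := List.length_pos_of_ne_nil hw
  refine ⟨P.length + w.length, ?_, ?_⟩
  · rw [← h]; simp
  · rw [pathAction, hg _ (pathPerm_mul_self _), pathPerm_prod_apply]
    · omega
    · intro r hr
      rw [← h, List.append_assoc, List.getElem?_append_right (by omega),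
        List.getElem?_append_left (by omega)]
      congr 1; omega

/-! ### The sequence of subgroups -/

theorem proposition2 :
    ¬ IsAmenableGroup F₂ ∧
    ∃ N : ℕ → Subgroup F₂,
      (∀ n, (N n).FiniteIndex) ∧
      IsFaithfulSequence N ∧
      ∀ (Y : Type) [MetricSpace Y],
        IsCoarseDisjointUnion (fun n => Sch (N n)) Y → HasPropertyA Y := by
  refine ⟨not_isAmenableGroup_F₂, ?_⟩
  have hne : Nonempty {g : F₂ // g ≠ 1} := ⟨⟨FreeGroup.of 0, FreeGroup.of_ne_one 0⟩⟩
  have hcount : Countable F₂ := FreeGroup.toWord_injective.countable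
  obtain ⟨γ, hγ⟩ := exists_surjective_nat {g : F₂ // g ≠ 1}
  choose w hw hwc hwg using fun n => exists_word_of_ne_one (Equiv.Perm ℕ) (γ n).1 (γ n).2
  choose L hL hwL using exists_isChain_infix w hwc
  -- `L (n + 1)` contains the words of `γ 0, …, γ n`, so all of these move vertices of path `n`.
  -- This gives eventual nontriviality; the choice of base point `q n`, moved by `γ n` itself, gives
  -- the trivial intersection.
  have hmove : ∀ n, ∀ i ≤ n, ∃ q ≤ (L (n + 1)).length,
      pathAction (isProperColouring_getElem? (hL (n + 1))) (γ i) q ≠ q := fun n i hi =>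
    exists_pathAction_ne (hL (n + 1)) (hw i) (hwL (n + 1) i (by omega)) (hwg i)
  choose q hq hqne using fun n => hmove n n le_rfl
  have hlen : ∀ n i, ((L (n + 1))[i]?).isSome ↔ i < (L (n + 1)).length := fun n i => by simp
  choose f hinj hrange hf hf' hequiv using fun n =>
    exists_sch_pathStabilizer_coord (isProperColouring_getElem? (hL (n + 1))) (hlen n) (hq n)
  refine ⟨fun n => pathStabilizer (isProperColouring_getElem? (hL (n + 1))) (q n),
    fun n => ?_, ⟨?_, ?_⟩, fun Y _ hY => hY.hasPropertyA_of_intervals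
      (fun n => (L (n + 1)).length + 1) f hinj hrange hf hf'⟩
  · have hfin : Finite (F₂ ⧸ (pathStabilizer (isProperColouring_getElem? (hL (n + 1))) (q n))) :=
      Set.finite_range_iff (hinj n) |>.1 (by rw [hrange]; exact Set.finite_lt_nat _)
    exact Subgroup.finiteIndex_of_finite_quotient
  · rw [eq_bot_iff]
    intro g hg
    by_contra hg1
    obtain ⟨n, hn⟩ := hγ ⟨g, hg1⟩
    have hgn := (Subgroup.mem_iInf.1 hg) n
    rw [mem_pathStabilizer] at hgn
    apply hqne n
    rw [hn]
    exact hgn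
  · intro g hg
    obtain ⟨i, hi⟩ := hγ ⟨g, hg⟩
    filter_upwards [eventually_ge_atTop i] with n hn
    obtain ⟨r, hr, hrne⟩ := hmove n i hn
    obtain ⟨x, hx⟩ : r ∈ Set.range (f n) := by
      rw [hrange]; exact Nat.lt_succ_of_le hr
    refine ⟨x, fun h => hrne ?_⟩
    have := hequiv n g x
    rw [h, hx] at this
    rw [hi]
    exact this.symm
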